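/- **Setting.** Let $d\ge 1$ and let $\mathbb M=\mathbb R^{1+d}$ be Minkowski spacetime with metric of signature $(+,-,\dots,-)$. A *region* is an open, bounded, causally convex subset of $\mathbb M$. Let $\mathcal A$ be a unital C$^*$-algebra, the quasi-local algebra of a local, translation-covariant quantum field theory. That is, to every region $O$ is assigned a unital C$^*$-subalgebra $\mathcal A(O)\subseteq\mathcal A$ such that $\mathcal A=\overline{\bigcup_O\mathcal A(O)}$ (norm closure) and: * (isotony) $\mathcal A(O_1)\subseteq\mathcal A(O_2)$ whenever $O_1\subseteq O_2$; * (locality) $[\mathcal A(O_1),\mathcal A(O)]=\{0\}$ whenever every point of $O_1$ is spacelike separated from every point of $O$; * (translation covariance) the group $(\mathbb R^{1+d},+)$ is represented on $\mathcal A$ by $^*$-automorphisms $\{\delta_x\}_{x\in\mathbb R^{1+d}}$ with $\delta_x(\mathcal A(O))=\mathcal A(O+x)$ for all regions $O$ and all $x$. No continuity of $x\mapsto\delta_x$ is assumed. For a future-directed timelike unit vector $u$ (the time direction of an inertial frame), put $\alpha^{(u)}_t=\delta_{tu}$ for $t\in\mathbb R$. **Definitions.** A *state* $\omega$ on $\mathcal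 A$ is a positive, normalized linear functional. Let $\pi_\omega$ be its GNS representation, on $\mathcal H_\omega$. Let $\alpha=\{\alpha_t\}_{t\in\mathbb R}$ be a one-parameter group of $^*$-automorphisms of $\mathcal A$. * $\omega$ is *primary* if $\pi_\omega(\mathcal A)''\cap\pi_\omega(\mathcal A)'=\mathbb C\mathbf 1$. * $(\mathcal A,\alpha,\omega)$ *satisfies the mixing property* if $\omega\circ\alpha_t=\omega$ for all $t\in\mathbb R$ and $\lim_{t\to\infty}\omega(B\,\alpha_t(A))=\omega(A)\,\omega(B)$ for all $A,B\in\mathcal A$. * $\omega$ is a *KMS state with respect to $\alpha$* if there is $\beta\in\mathbb R\setminus\{0\}$ such that for all $A,B\in\mathcal A$ there is a function $F$ which is bounded and continuous on the strip $\{z\in\mathbb C: 0\le\operatorname{sgn}(\beta)\operatorname{Im}z\le|\beta|\}$, analytic in its interior, and satisfies $F(t)=\omega(A\,\alpha_t(B))$ and $F(t+i\beta)=\omega(\alpha_t(B)\,A)$ for all $t\in\mathbb R$. * The *folium* of $\omega$ is the set of states $\operatorname{tr}(\rho\,\pi_\omega(\cdot))$ with $\rho$ a density operator (a positive trace class operator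 with $\operatorname{tr}\rho=1$) on $\mathcal H_\omega$. Two states are *disjoint* if their folia have empty intersection. **Corollary (Disjointness of inertial KMS states).** Let $u,w$ be linearly independent future-directed timelike unit vectors in $\mathbb M$. Let $\sigma$ be a KMS state on $\mathcal A$ with respect to $\alpha^{(u)}$ and let $\omega$ be a KMS state on $\mathcal A$ with respect to $\alpha^{(w)}$; their KMS parameters may differ. If $\sigma$ and $\omega$ are primary, $(\mathcal A,\alpha^{(u)},\sigma)$ and $(\mathcal A,\alpha^{(w)},\omega)$ satisfy the mixing property, and $\sigma\neq\omega$, then $\sigma$ and $\omega$ are disjoint. -/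

import Mathlib

open scoped ComplexOrder InnerProductSpace
open Filter Topology

namespace AQFT

noncomputable section

/-! ### Minkowski spacetime -/

/-- The set underlying `(1 + d)`-dimensional Minkowski spacetime; the coordinate `0` is time. -/
abbrev Spacetime (d : ℕ) : Type := Fin (d + 1) → ℝ

/-- The Minkowski form of signature `(+, -, …, -)`. -/
def minkowski {d : ℕ} (x y : Spacetime d) : ℝ :=
  x 0 * y 0 - ∑ i : Fin d, x i.succ * y i.succ

/-- `y` lies in the causal future `J⁺(x)` of `x`: the vector `y - x` is zero or a future-directed
timelike or lightlike vector. -/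
def CausallyPrecedes {d : ℕ} (x y : Spacetime d) : Prop :=
  0 ≤ (y - x) 0 ∧ 0 ≤ minkowski (y - x) (y - x)

/-- A set is causally convex if it contains every causal curve with endpoints in the set. The
union of the causal curves from `x` to `y` is the diamond `J⁺(x) ∩ J⁻(y)`. -/
def CausallyConvex {d : ℕ} (O : Set (Spacetime d)) : Prop :=
  ∀ x ∈ O, ∀ y ∈ O, ∀ z, CausallyPrecedes x z → CausallyPrecedes z y → z ∈ O

/-- The causal complement of `O`: the points that are spacelike separated from every point of
`O`. -/
def causalComplement {d : ℕ} (O : Set (Spacetime d)) : Set (Spacetime d) :=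
  {x | ∀ y ∈ O, minkowski (x - y) (x - y) < 0}

/-- The time direction of an inertial frame: a future-directed timelike unit vector. -/
def IsFrame {d : ℕ} (u : Spacetime d) : Prop :=
  0 < u 0 ∧ minkowski u u = 1

/-- Regions: the open, bounded, causally convex subsets of Minkowski spacetime. -/
structure Region (d : ℕ) where
  carrier : Set (Spacetime d)
  isOpen : IsOpen carrier
  isBounded : Bornology.IsBounded carrier
  causallyConvex : CausallyConvex carrier

/-- The translated region `O + x = {y + x | y ∈ O}`. -/
def Region.translate {d : ℕ} (O : Region d) (x : Spacetime d) : Region d where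
  carrier := (fun y => y + x) '' O.carrier
  isOpen := (Homeomorph.addRight x).isOpenMap _ O.isOpen
  isBounded := by
    simpa [Set.add_singleton] using
      O.isBounded.add (Bornology.isBounded_singleton (x := x))
  causallyConvex := by
    rintro _ ⟨a, ha, rfl⟩ _ ⟨b, hb, rfl⟩ z hz hz'
    refine ⟨z - x, O.causallyConvex a ha b hb _ ?_ ?_, by simp⟩
    · have h : z - x - a = z - (a + x) := by abel
      simpa only [CausallyPrecedes, h] using hz
    · have h : b - (z - x) = b + x - z := by abel
      simpa only [CausallyPrecedes, h] using hz'

/-! ### Local, translation-covariant quantum field theories -/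

section Algebra

variable {A : Type*} [CStarAlgebra A]

/-- One-parameter groups of *-automorphisms of `A` (no continuity in the parameter). -/
abbrev Dynamics (A : Type*) [CStarAlgebra A] : Type _ :=
  Multiplicative ℝ →* (A ≃⋆ₐ[ℂ] A)

/-- The automorphism at time `t`. -/
def Dynamics.at (α : Dynamics A) (t : ℝ) : A ≃⋆ₐ[ℂ] A := α (Multiplicative.ofAdd t)

/-- A local, translation-covariant net of unital C*-algebras over the regions of Minkowski
spacetime with quasi-local algebra `A`; the local algebras are regarded as subalgebras of `A`. -/
structure LocalNet (d : ℕ) (A : Type*) [CStarAlgebra A] where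
  /-- the local observable algebras -/
  localAlg : Region d → StarSubalgebra ℂ A
  /-- each of them is a C*-algebra, that is, norm closed -/
  isClosed_localAlg : ∀ O, IsClosed (localAlg O : Set A)
  /-- `A` is the norm closure of the union of the local algebras -/
  closure_iUnion : closure (⋃ O, (localAlg O : Set A)) = Set.univ
  isotony : ∀ O₁ O₂ : Region d, O₁.carrier ⊆ O₂.carrier → localAlg O₁ ≤ localAlg O₂
  locality : ∀ O₁ O : Region d, O₁.carrier ⊆ causalComplement O.carrier →
    ∀ a ∈ localAlg O₁, ∀ b ∈ localAlg O, a * b = b * a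
  /-- the representation of the translation group by *-automorphisms -/
  translation : Multiplicative (Spacetime d) →* (A ≃⋆ₐ[ℂ] A)
  covariance : ∀ (O : Region d) (x : Spacetime d),
    translation (Multiplicative.ofAdd x) '' (localAlg O : Set A) = localAlg (O.translate x)

/-- The inertial time evolution with time direction `u`: translation by `t • u` at time `t`. -/
def LocalNet.timeTranslation {d : ℕ} (N : LocalNet d A) (u : Spacetime d) : Dynamics A :=
  N.translation.comp (LinearMap.toSpanSingleton ℝ (Spacetime d) u).toAddMonoidHom.toMultiplicative

lemma LocalNet.timeTranslation_at {d : ℕ} (N : LocalNet d A) (u : Spacetime d) (t : ℝ) :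
    (N.timeTranslation u).at t = N.translation (Multiplicative.ofAdd (t • u)) := rfl

end Algebra

/-! ### Density operators -/

section Trace

variable {H : Type*} [NormedAddCommGroup H] [InnerProductSpace ℂ H] [CompleteSpace H]

/-- `T` is a trace class operator with trace `c`: in every orthonormal basis the diagonal of `T`
is summable with sum `c`. (A bounded operator is of trace class iff its diagonal is summable in
every orthonormal basis, and the sum is then independent of the basis.) -/
def HasTrace (T : H →L[ℂ] H) (c : ℂ) : Prop :=
  ∀ (s : Set H) (b : HilbertBasis s ℂ H), HasSum (fun i => ⟪b i, T (b i)⟫_ℂ) c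

/-- Density operators: positive trace class operators of trace one. -/
def IsDensityOperator (ρ : H →L[ℂ] H) : Prop :=
  ρ.IsPositive ∧ HasTrace ρ 1

/-- A von Neumann algebra is a factor if its center consists of the multiples of the identity. -/
def IsFactor (M : VonNeumannAlgebra H) : Prop :=
  ∀ X : H →L[ℂ] H, X ∈ M → X ∈ M.commutant → ∃ c : ℂ, X = c • (1 : H →L[ℂ] H)

end Trace

/-! ### States -/

section States

variable {A : Type*} [CStarAlgebra A] [PartialOrder A] [StarOrderedRing A]

/-- States: positive, normalized, linear functionals. -/
abbrev State (A : Type*) [CStarAlgebra A] [PartialOrder A] [StarOrderedRing A] : Type _ :=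
  {φ : A →ₚ[ℂ] ℂ // φ 1 = 1}

/-- The von Neumann algebra `π_ω(A)''` induced by `ω` on its GNS Hilbert space. -/
def inducedVNA (ω : State A) : VonNeumannAlgebra ω.1.GNS where
  toStarSubalgebra := StarSubalgebra.centralizer ℂ
    (StarSubalgebra.centralizer ℂ (Set.range ω.1.gnsStarAlgHom) : Set (ω.1.GNS →L[ℂ] ω.1.GNS))
  centralizer_centralizer' := by simp

lemma coe_inducedVNA (ω : State A) :
    (inducedVNA ω : Set (ω.1.GNS →L[ℂ] ω.1.GNS)) =
      Set.centralizer (Set.centralizer (Set.range ω.1.gnsStarAlgHom)) := by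
  have h : star (Set.range ω.1.gnsStarAlgHom) = Set.range ω.1.gnsStarAlgHom := by
    ext X
    constructor
    · rintro ⟨a, ha⟩
      exact ⟨star a, by rw [map_star, ha, star_star]⟩
    · rintro ⟨a, rfl⟩
      exact ⟨star a, by rw [map_star]⟩
  have h' : (inducedVNA ω : Set (ω.1.GNS →L[ℂ] ω.1.GNS)) =
      (StarSubalgebra.centralizer ℂ
        (StarSubalgebra.centralizer ℂ (Set.range ω.1.gnsStarAlgHom) :
          Set (ω.1.GNS →L[ℂ] ω.1.GNS)) : Set (ω.1.GNS →L[ℂ] ω.1.GNS)) := rfl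
  rw [h', StarSubalgebra.coe_centralizer_centralizer, h, Set.union_self]

/-- Primary states (factor states). -/
def IsPrimary (ω : State A) : Prop := IsFactor (inducedVNA ω)

/-- The folium of `ω`: the states `tr(ρ π_ω(·))` with a density operator `ρ` on the GNS Hilbert
space of `ω`. -/
def folium (ω : State A) : Set (State A) :=
  {φ | ∃ ρ : ω.1.GNS →L[ℂ] ω.1.GNS, IsDensityOperator ρ ∧
    ∀ a : A, HasTrace (ρ * ω.1.gnsStarAlgHom a) (φ.1 a)}

/-- Two states are disjoint if no state is normal to both of them. -/
def AreDisjoint (σ ω : State A) : Prop := folium σ ∩ folium ω = ∅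

/-- Invariance of a state under a one-parameter group of *-automorphisms. -/
def IsInvariant (α : Dynamics A) (ω : State A) : Prop :=
  ∀ (t : ℝ) (a : A), ω.1 (α.at t a) = ω.1 a

/-- The mixing property of an invariant state. -/
def IsMixing (α : Dynamics A) (ω : State A) : Prop :=
  IsInvariant α ω ∧
    ∀ a b : A, Tendsto (fun t : ℝ => ω.1 (b * α.at t a)) atTop (𝓝 (ω.1 a * ω.1 b))

/-- The closed strip between the real line and the line `Im z = β`. -/
def kmsStrip (β : ℝ) : Set ℂ :=
  {z | 0 ≤ Real.sign β * z.im ∧ Real.sign β * z.im ≤ |β|}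

/-- `(α, β)`-KMS states, for a KMS parameter `β ≠ 0` of either sign. -/
def IsKMS (α : Dynamics A) (β : ℝ) (ω : State A) : Prop :=
  β ≠ 0 ∧ ∀ a b : A, ∃ F : ℂ → ℂ,
    (∃ C : ℝ, ∀ z ∈ kmsStrip β, ‖F z‖ ≤ C) ∧
    ContinuousOn F (kmsStrip β) ∧
    DifferentiableOn ℂ F (interior (kmsStrip β)) ∧
    ∀ t : ℝ, F t = ω.1 (a * α.at t b) ∧ F (t + Complex.I * β) = ω.1 (α.at t b * a)

end States

end

end AQFT

open AQFT

open scoped ComplexOrder InnerProductSpace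
open Filter Topology
open AQFT

namespace AQFT

/-! ### Gaussian integrals on the KMS strip -/

section Strip

open Complex MeasureTheory

/-! Suppose some state `φ` lies in both folia. Mixing and the KMS condition upgrade two-point
clustering to `σ (b * α_t a * c) → σ a * σ (b * c)` (`IsMixing.tendsto_apply_mul_mul`): the
operators representing `α_t a` converge weakly to the scalar `σ a` in the GNS representation of `σ`.
No norm continuity of the dynamics is available, so `c` is smeared with a Gaussian, moved to the
left by shifting the contour across the strip, and recovered by letting the Gaussian concentrate.

Weak convergence to scalars passes from `σ` to `φ` through the sum of vector functionals
representing `φ`. It passes from `φ` to `ω` through a nonzero intertwiner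
(`exists_intertwiner_of_mem_folium`): the set of vectors where it holds stably under the algebra is
the range of a central projection, which is `1` since `ω` is primary
(`IsPrimary.equilibriumSubspace_eq_top`). Hence `ω (α_t a) → σ a`, and by symmetry `σ (α'_t a) → ω
a`.

Both dynamics are translations, so they commute. The first limit makes `σ` inherit the
`α'`-invariance of `ω`; the second is then the limit of a constant, so `σ = ω`. -/

lemma mem_kmsStrip_iff {β : ℝ} (hβ : β ≠ 0) {z : ℂ} : z ∈ kmsStrip β ↔ z.im ∈ Set.uIcc 0 β := by
  rcases hβ.lt_or_gt with h | h
  · simp only [kmsStrip, Set.mem_ofPred_eq, Real.sign_of_neg h, abs_of_neg h, Set.uIcc_of_ge h.le,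
      Set.mem_Icc]
    constructor <;> rintro ⟨h₁, h₂⟩ <;> constructor <;> linarith
  · simp only [kmsStrip, Set.mem_ofPred_eq, Real.sign_of_pos h, abs_of_pos h, Set.uIcc_of_le h.le,
      Set.mem_Icc, one_mul]

lemma ofReal_mem_kmsStrip {β : ℝ} (hβ : β ≠ 0) (t : ℝ) : (t : ℂ) ∈ kmsStrip β := by
  simp [mem_kmsStrip_iff hβ]

lemma ofReal_add_mem_kmsStrip {β : ℝ} (hβ : β ≠ 0) (t : ℝ) : (t : ℂ) + I * β ∈ kmsStrip β := by
  simp [mem_kmsStrip_iff hβ]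

/-- On the strip `|Im z| ≤ |β|`, so the growth of the Gaussian in the imaginary direction costs only
the constant `exp (c * β ^ 2)`. This one bound gives integrability on horizontal lines and decay on
vertical sides. -/
lemma norm_gaussian_mul_le {β c K : ℝ} (hc : 0 < c) {z : ℂ} (hz : z.im ∈ Set.uIcc 0 β) {y : ℂ}
    (hy : ‖y‖ ≤ K) :
    ‖cexp (-c * z ^ 2) * y‖ ≤ Real.exp (c * β ^ 2) * K * Real.exp (-c * z.re ^ 2) := by
  have him : z.im ^ 2 ≤ β ^ 2 := by
    rw [sq_le_sq]
    have := Set.abs_sub_left_of_mem_uIcc hz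
    simpa using this
  rw [norm_mul, norm_exp]
  have hre : (-(c : ℂ) * z ^ 2).re = -c * z.re ^ 2 + c * z.im ^ 2 := by
    simp [pow_two]; ring
  calc Real.exp (-(c : ℂ) * z ^ 2).re * ‖y‖
      ≤ Real.exp (-c * z.re ^ 2 + c * β ^ 2) * K := by
        gcongr
        rw [hre]
        gcongr
    _ = _ := by rw [Real.exp_add]; ring

/-- The integrals of a bounded holomorphic function on a strip against a Gaussian along the two
boundary lines agree. -/
lemma integral_gaussian_mul_eq_shift {β c K : ℝ} (hβ : β ≠ 0) (hc : 0 < c) {g : ℂ → ℂ}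
    (hK : ∀ z ∈ kmsStrip β, ‖g z‖ ≤ K) (hg : ContinuousOn g (kmsStrip β))
    (hd : DifferentiableOn ℂ g (interior (kmsStrip β))) :
    ∫ t : ℝ, cexp (-c * (t : ℂ) ^ 2) * g t =
      ∫ t : ℝ, cexp (-c * ((t : ℂ) + I * β) ^ 2) * g (t + I * β) := by
  set G : ℂ → ℂ := fun z => cexp (-c * z ^ 2) * g z with hG
  have hGc : ContinuousOn G (kmsStrip β) := by
    apply ContinuousOn.mul _ hg
    fun_prop
  have hGd : DifferentiableOn ℂ G (interior (kmsStrip β)) := by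
    apply DifferentiableOn.mul _ hd
    fun_prop
  have hGb : ∀ z : ℂ, z.im ∈ Set.uIcc 0 β →
      ‖G z‖ ≤ Real.exp (c * β ^ 2) * K * Real.exp (-c * z.re ^ 2) := fun z hz =>
    norm_gaussian_mul_le hc hz (hK z ((mem_kmsStrip_iff hβ).2 hz))
  have hgauss : Integrable fun x : ℝ => Real.exp (c * β ^ 2) * K * Real.exp (-c * x ^ 2) :=
    (integrable_exp_neg_mul_sq hc).const_mul _
  have hint : ∀ y ∈ Set.uIcc 0 β, Integrable fun x : ℝ => G (x + I * y) := by
    intro y hy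
    refine hgauss.mono' ?_ (Eventually.of_forall fun x => ?_)
    · apply Continuous.aestronglyMeasurable
      refine hGc.comp_continuous (by fun_prop) fun x => ?_
      rw [mem_kmsStrip_iff hβ]; simpa using hy
    · have := hGb (x + I * y) (by simpa using hy)
      simpa using this
  have hlim : ∀ y ∈ Set.uIcc 0 β, Tendsto (fun R : ℝ => ∫ x : ℝ in (-R)..R, G (x + I * y)) atTop
      (𝓝 (∫ x : ℝ, G (x + I * y))) := fun y hy =>
    intervalIntegral_tendsto_integral (hint y hy) tendsto_neg_atTop_atBot tendsto_id
  -- Taking `s` to be the identity or negation covers both vertical sides of the rectangle.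
  have hvert : ∀ s : ℝ → ℝ, (∀ R, s R ^ 2 = R ^ 2) →
      Tendsto (fun R : ℝ => ∫ y : ℝ in 0..β, G (s R + y * I)) atTop (𝓝 0) := by
    intro s hs
    have hb : Tendsto (fun R : ℝ => Real.exp (c * β ^ 2) * K * Real.exp (-c * R ^ 2) * |β - 0|)
        atTop (𝓝 0) := by
      have h1 : Tendsto (fun R : ℝ => Real.exp (-c * R ^ 2)) atTop (𝓝 0) := by
        apply Real.tendsto_exp_atBot.comp
        exact (tendsto_pow_atTop (two_ne_zero)).const_mul_atTop_of_neg (by linarith)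
      simpa using (h1.const_mul (Real.exp (c * β ^ 2) * K)).mul_const |β - 0|
    refine squeeze_zero_norm (fun R => ?_) hb
    refine intervalIntegral.norm_integral_le_of_norm_le_const fun y hy => ?_
    have := hGb (s R + y * I) (by simpa using Set.uIoc_subset_uIcc hy)
    simpa [hs] using this
  have hrect : ∀ R : ℝ, (∫ x : ℝ in (-R)..R, G (x + I * (0 : ℝ)))
      - (∫ x : ℝ in (-R)..R, G (x + I * β)) + I • (∫ y : ℝ in 0..β, G (R + y * I))
      - I • (∫ y : ℝ in 0..β, G ((-R : ℝ) + y * I)) = 0 := by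
    intro R
    have h := Complex.integral_boundary_rect_eq_zero_of_continuousOn_of_differentiableOn G
      ((-R : ℝ) : ℂ) (R + I * β) (hGc.mono ?_) (hGd.mono ?_)
    · simpa [mul_comm I] using h
    · intro z hz
      rw [mem_kmsStrip_iff hβ]
      simpa using hz.2
    · refine interior_maximal (fun z hz => ?_) (isOpen_Ioo.reProdIm isOpen_Ioo)
      rw [mem_kmsStrip_iff hβ]
      have := hz.2
      simp only [ofReal_im, add_im, mul_im, I_re, zero_mul, I_im, one_mul, zero_add, ofReal_re,
        Set.mem_preimage] at this
      exact Set.Ioo_subset_Icc_self this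
  have h0 := (((hlim 0 (by simp)).sub (hlim β (by simp))).add
    ((hvert id fun _ => rfl).const_smul I)).sub ((hvert (fun R => -R) fun R => by ring).const_smul I)
  have h1 := tendsto_nhds_unique (h0.congr hrect) tendsto_const_nhds
  simp only [smul_zero, add_zero, sub_zero] at h1
  simpa [hG] using sub_eq_zero.1 h1

/-- Averages of `h` against Gaussians concentrating at `0`. -/
lemma tendsto_gaussian_average {h : ℝ → ℝ} (hc : Continuous h) (h0 : h 0 = 0) {K : ℝ}
    (hK : ∀ t, ‖h t‖ ≤ K) :
    Tendsto (fun n : ℕ => n * ∫ t : ℝ, Real.exp (-(n : ℝ) ^ 2 * t ^ 2) * h t) atTop (𝓝 0) := by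
  -- Substitution `x = n * t`: the weight becomes fixed and the concentration moves into the
  -- argument of `h`.
  have key : ∀ᶠ n : ℕ in atTop, ∫ x : ℝ, Real.exp (-1 * x ^ 2) * h ((n : ℝ)⁻¹ * x) =
      n * ∫ t : ℝ, Real.exp (-(n : ℝ) ^ 2 * t ^ 2) * h t := by
    filter_upwards [eventually_gt_atTop 0] with n hn
    have hn' : (n : ℝ) ≠ 0 := by positivity
    have := Measure.integral_comp_mul_left
      (fun t : ℝ => Real.exp (-(n : ℝ) ^ 2 * t ^ 2) * h t) ((n : ℝ)⁻¹)
    rw [inv_inv, abs_of_nonneg (Nat.cast_nonneg n), smul_eq_mul] at this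
    rw [← this]
    congr 1 with x
    congr 2
    field_simp
  refine Tendsto.congr' key ?_
  have hlim : Tendsto (fun n : ℕ => ∫ x : ℝ, Real.exp (-1 * x ^ 2) * h ((n : ℝ)⁻¹ * x)) atTop
      (𝓝 (∫ _ : ℝ, (0 : ℝ))) := by
    refine tendsto_integral_of_dominated_convergence (fun x => Real.exp (-1 * x ^ 2) * K)
      (fun n => ?_) ((integrable_exp_neg_mul_sq one_pos).mul_const K) (fun n => ?_) ?_
    · apply Continuous.aestronglyMeasurable
      fun_prop
    · refine Eventually.of_forall fun x => ?_
      rw [norm_mul, Real.norm_of_nonneg (Real.exp_pos _).le]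
      gcongr
      exact hK _
    · refine Eventually.of_forall fun x => ?_
      have h1 : Tendsto (fun n : ℕ => (n : ℝ)⁻¹ * x) atTop (𝓝 0) := by
        simpa using tendsto_inv_atTop_nhds_zero_nat.mul_const x
      have h2 := (hc.tendsto 0).comp h1
      rw [h0] at h2
      have h3 := h2.const_mul (Real.exp (-1 * x ^ 2))
      rwa [mul_zero] at h3
  simpa using hlim

end Strip
end AQFT

namespace AQFT

section Dynamics

variable {A : Type*} [CStarAlgebra A]

lemma Dynamics.at_zero (α : Dynamics A) (a : A) : α.at 0 a = a := by
  simp [Dynamics.at]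

lemma Dynamics.norm_at (α : Dynamics A) (t : ℝ) (a : A) : ‖α.at t a‖ = ‖a‖ :=
  NonUnitalStarAlgHom.norm_map (α.at t) (α.at t).injective a

end Dynamics

/-! ### GNS vectors and norm estimates -/

section GNS

variable {A : Type*} [CStarAlgebra A] [PartialOrder A] [StarOrderedRing A]

/-- The vector `π_ω(a) Ω` of the GNS space, as a linear function of `a`. -/
noncomputable def gnsVec (ω : State A) : A →ₗ[ℂ] ω.1.GNS :=
  (UniformSpace.Completion.toComplL (𝕜 := ℂ) (E := ω.1.PreGNS)).toLinearMap ∘ₗ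
    ω.1.toPreGNS.toLinearMap

lemma gnsVec_eq_coe (ω : State A) (a : A) :
    gnsVec ω a = ((ω.1.toPreGNS a : ω.1.PreGNS) : ω.1.GNS) := rfl

lemma inner_gnsVec (ω : State A) (a b : A) :
    ⟪gnsVec ω a, gnsVec ω b⟫_ℂ = ω.1 (star a * b) := by
  simp [gnsVec_eq_coe, PositiveLinearMap.preGNS_inner_def]

lemma gnsStarAlgHom_gnsVec (ω : State A) (a b : A) :
    ω.1.gnsStarAlgHom a (gnsVec ω b) = gnsVec ω (a * b) := by
  simp [gnsVec_eq_coe]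

lemma denseRange_gnsVec (ω : State A) : DenseRange (gnsVec ω) :=
  UniformSpace.Completion.denseRange_coe (α := ω.1.PreGNS)

lemma norm_gnsVec_one (ω : State A) : ‖gnsVec ω 1‖ = 1 := by
  have h := inner_gnsVec ω 1 1
  rw [star_one, one_mul, ω.2] at h
  rw [@norm_eq_sqrt_re_inner ℂ, h]
  simp

lemma norm_gnsStarAlgHom_le (ω : State A) (a : A) : ‖ω.1.gnsStarAlgHom a‖ ≤ ‖a‖ :=
  NonUnitalStarAlgHom.norm_apply_le _ a

lemma norm_gnsVec_le (ω : State A) (a : A) : ‖gnsVec ω a‖ ≤ ‖a‖ := by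
  have h := (ω.1.gnsStarAlgHom a).le_of_opNorm_le (norm_gnsStarAlgHom_le ω a) (gnsVec ω 1)
  rwa [gnsStarAlgHom_gnsVec, mul_one, norm_gnsVec_one, mul_one] at h

lemma inner_gnsVec_gnsStarAlgHom (ω : State A) (a b c : A) :
    ⟪gnsVec ω a, ω.1.gnsStarAlgHom b (gnsVec ω c)⟫_ℂ = ω.1 (star a * b * c) := by
  rw [gnsStarAlgHom_gnsVec, inner_gnsVec, mul_assoc]

/-- Cauchy–Schwarz, keeping the GNS norm on the right factor: `t ↦ α_t c` is continuous in that norm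
for an invariant KMS state, but perhaps not in the C*-norm. -/
lemma norm_state_mul_le (ω : State A) (a b : A) : ‖ω.1 (a * b)‖ ≤ ‖a‖ * ‖gnsVec ω b‖ := by
  have h := inner_gnsVec ω (star a) b
  rw [star_star] at h
  rw [← h]
  refine (norm_inner_le_norm _ _).trans ?_
  gcongr
  simpa using norm_gnsVec_le ω (star a)

lemma norm_state_le (ω : State A) (a : A) : ‖ω.1 a‖ ≤ ‖a‖ := by
  simpa [norm_gnsVec_one] using norm_state_mul_le ω a 1

end GNS

/-! ### Return to equilibrium for mixing KMS states -/

section Equilibrium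

open Complex MeasureTheory

variable {A : Type*} [CStarAlgebra A] [PartialOrder A] [StarOrderedRing A]

/-- The only source of continuity in time: the correlation functions are boundary values of a
function continuous on the closed strip. -/
lemma IsKMS.continuous_apply {α : Dynamics A} {β : ℝ} {ω : State A} (h : IsKMS α β ω) (a b : A) :
    Continuous fun t : ℝ => ω.1 (a * α.at t b) := by
  obtain ⟨hβ, h⟩ := h
  obtain ⟨F, -, hF, -, hval⟩ := h a b
  exact (hF.comp_continuous continuous_ofReal (ofReal_mem_kmsStrip hβ)).congr fun t => (hval t).1

lemma IsKMS.continuous_apply' {α : Dynamics A} {β : ℝ} {ω : State A} (h : IsKMS α β ω) (a b : A) :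
    Continuous fun t : ℝ => ω.1 (α.at t b * a) := by
  obtain ⟨hβ, h⟩ := h
  obtain ⟨F, -, hF, -, hval⟩ := h a b
  exact (hF.comp_continuous (by fun_prop) (ofReal_add_mem_kmsStrip hβ)).congr
    fun t => (hval t).2

lemma IsKMS.integral_gaussian {α : Dynamics A} {β : ℝ} {ω : State A} (h : IsKMS α β ω) (a b : A)
    {c : ℝ} (hc : 0 < c) :
    ∫ t : ℝ, cexp (-c * (t : ℂ) ^ 2) * ω.1 (a * α.at t b) =
      ∫ t : ℝ, cexp (-c * ((t : ℂ) + I * β) ^ 2) * ω.1 (α.at t b * a) := by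
  obtain ⟨hβ, h⟩ := h
  obtain ⟨F, ⟨K, hK⟩, hF, hd, hval⟩ := h a b
  simpa only [(hval _).1, (hval _).2] using integral_gaussian_mul_eq_shift hβ hc hK hF hd

/-- By invariance, expanding the square leaves a single time-dependent term, a two-point function.
-/
lemma IsKMS.continuous_norm_gnsVec {α : Dynamics A} {β : ℝ} {ω : State A} (h : IsKMS α β ω)
    (hinv : IsInvariant α ω) (c : A) : Continuous fun t : ℝ => ‖gnsVec ω (α.at t c - c)‖ := by
  have key : ∀ t : ℝ, ‖gnsVec ω (α.at t c - c)‖ =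
      √(2 * (ω.1 (star c * c)).re - 2 * (ω.1 (star c * α.at t c)).re) := by
    intro t
    have hre : ∀ x : A, ‖gnsVec ω x‖ ^ 2 = (ω.1 (star x * x)).re := fun x => by
      rw [← inner_gnsVec]; exact norm_sq_eq_re_inner (𝕜 := ℂ) _
    have hn : ‖gnsVec ω (α.at t c)‖ ^ 2 = ‖gnsVec ω c‖ ^ 2 := by
      rw [hre, hre, ← map_star, ← map_mul, hinv]
    have h2 := norm_sub_sq (𝕜 := ℂ) (gnsVec ω c) (gnsVec ω (α.at t c))
    rw [norm_sub_rev, ← map_sub, hn, inner_gnsVec, hre c] at h2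
    rw [← Real.sqrt_sq (norm_nonneg _), h2]
    congr 1
    simp only [RCLike.re_to_complex]
    ring
  simp only [key]
  have := h.continuous_apply (star c) c
  fun_prop

/-- Smeared mixing: the KMS condition moves `α_t(c)` to the left. -/
lemma IsMixing.tendsto_integral_gaussian {α : Dynamics A} {β : ℝ} {ω : State A} (h : IsKMS α β ω)
    (hmix : IsMixing α ω) (a b c : A) {r : ℝ} (hr : 0 < r) :
    Tendsto (fun s : ℝ => ∫ t : ℝ, cexp (-r * (t : ℂ) ^ 2) *
      ω.1 (b * (α.at s a - algebraMap ℂ A (ω.1 a)) * α.at t c)) atTop (𝓝 0) := by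
  -- The shift puts the time-evolved `a` at the right end, where the two-factor mixing property
  -- applies for each fixed `t`.
  simp only [h.integral_gaussian _ _ hr]
  have hlim : Tendsto (fun s : ℝ => ∫ t : ℝ, cexp (-r * ((t : ℂ) + I * β) ^ 2) *
      ω.1 (α.at t c * (b * (α.at s a - algebraMap ℂ A (ω.1 a))))) atTop (𝓝 (∫ _ : ℝ, (0 : ℂ))) := by
    refine tendsto_integral_filter_of_dominated_convergence
      (fun t => Real.exp (r * β ^ 2) * (‖c‖ * (‖b‖ * (‖a‖ + ‖algebraMap ℂ A (ω.1 a)‖))) *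
        Real.exp (-r * t ^ 2)) (Eventually.of_forall fun s => ?_)
      (Eventually.of_forall fun s => Eventually.of_forall fun t => ?_)
      ((integrable_exp_neg_mul_sq hr).const_mul _) (Eventually.of_forall fun t => ?_)
    · have := h.continuous_apply' (b * (α.at s a - algebraMap ℂ A (ω.1 a))) c
      apply Continuous.aestronglyMeasurable
      fun_prop
    · have hb : ‖ω.1 (α.at t c * (b * (α.at s a - algebraMap ℂ A (ω.1 a))))‖ ≤
          ‖c‖ * (‖b‖ * (‖a‖ + ‖algebraMap ℂ A (ω.1 a)‖)) := by
        refine (norm_state_le ω _).trans ((norm_mul_le _ _).trans ?_)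
        rw [α.norm_at]
        gcongr
        refine (norm_mul_le _ _).trans ?_
        gcongr
        refine (norm_sub_le _ _).trans ?_
        rw [α.norm_at]
      simpa using norm_gaussian_mul_le (β := β) hr (z := (t : ℂ) + I * β) (by simp) hb
    · have h1 := hmix.2 a (α.at t c * b)
      have h2 : Tendsto (fun s : ℝ => ω.1 (α.at t c * (b * (α.at s a - algebraMap ℂ A (ω.1 a)))))
          atTop (𝓝 0) := by
        have h3 := h1.sub_const (ω.1 a * ω.1 (α.at t c * b))
        rw [sub_self] at h3
        refine h3.congr fun s => ?_
        rw [mul_sub, mul_sub, map_sub, Algebra.algebraMap_eq_smul_one, mul_smul_comm, mul_smul_comm,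
          mul_one, map_smul, smul_eq_mul, mul_assoc]
      have h4 := h2.const_mul (cexp (-r * ((t : ℂ) + I * β) ^ 2))
      rwa [mul_zero] at h4
  simpa using hlim

/-- Return to equilibrium for a mixing KMS state. -/
lemma IsMixing.tendsto_apply_mul_mul {α : Dynamics A} {β : ℝ} {ω : State A} (h : IsKMS α β ω)
    (hmix : IsMixing α ω) (a b c : A) :
    Tendsto (fun s : ℝ => ω.1 (b * α.at s a * c)) atTop (𝓝 (ω.1 a * ω.1 (b * c))) := by
  set X : ℝ → A := fun s => α.at s a - algebraMap ℂ A (ω.1 a) with hX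
  set M : ℝ := ‖b‖ * (‖a‖ + ‖algebraMap ℂ A (ω.1 a)‖) with hM
  have hXb : ∀ s, ‖b * X s‖ ≤ M := fun s => by
    refine (norm_mul_le _ _).trans ?_
    rw [hM]
    gcongr
    refine (norm_sub_le _ _).trans ?_
    rw [α.norm_at]
  set g : ℝ → ℝ := fun t => ‖gnsVec ω (α.at t c - c)‖ with hg
  have hgc : Continuous g := h.continuous_norm_gnsVec hmix.1 c
  have hg0 : g 0 = 0 := by simp [hg, α.at_zero]
  have hgK : ∀ t, ‖g t‖ ≤ 2 * ‖c‖ := fun t => by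
    rw [hg, norm_norm]
    refine (norm_gnsVec_le _ _).trans ((norm_sub_le _ _).trans ?_)
    rw [α.norm_at]; linarith
  have hgint : ∀ r : ℝ, 0 < r → Integrable fun t : ℝ => Real.exp (-r * t ^ 2) * g t := by
    intro r hr
    exact (integrable_exp_neg_mul_sq hr).mul_bdd (c := 2 * ‖c‖) hgc.aestronglyMeasurable
      (Eventually.of_forall hgK)
  have hDc : ∀ s, Continuous fun t : ℝ => ω.1 (b * X s * α.at t c) := fun s =>
    h.continuous_apply _ _
  -- The first term is the cost of replacing `c` by its smearing and is independent of `s`; the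
  -- second is the smeared correlation. The factor `√π` is `n` times the Gaussian integral.
  have hsmear : ∀ (s : ℝ) (n : ℕ), 0 < n → √Real.pi * ‖ω.1 (b * X s * c)‖ ≤
      M * (n * ∫ t : ℝ, Real.exp (-(n : ℝ) ^ 2 * t ^ 2) * g t) +
      n * ‖∫ t : ℝ, cexp (-((n : ℝ) ^ 2 : ℝ) * (t : ℂ) ^ 2) * ω.1 (b * X s * α.at t c)‖ := by
    intro s n hn
    have hn' : (0 : ℝ) < (n : ℝ) ^ 2 := by positivity
    have hG : Integrable fun t : ℝ => cexp (-((n : ℝ) ^ 2 : ℝ) * (t : ℂ) ^ 2) :=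
      integrable_cexp_neg_mul_sq (by rwa [ofReal_re])
    have hGn : ∀ t : ℝ, ‖cexp (-((n : ℝ) ^ 2 : ℝ) * (t : ℂ) ^ 2)‖ =
        Real.exp (-(n : ℝ) ^ 2 * t ^ 2) := fun t => by
      rw [norm_cexp_neg_mul_sq, ofReal_re]
    have hGv : (n : ℂ) * ∫ t : ℝ, cexp (-((n : ℝ) ^ 2 : ℝ) * (t : ℂ) ^ 2) = (√Real.pi : ℝ) := by
      have h1 := integral_gaussian ((n : ℝ) ^ 2)
      rw [Real.sqrt_div Real.pi_pos.le, Real.sqrt_sq (Nat.cast_nonneg n)] at h1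
      have h2 : ∫ t : ℝ, cexp (-((n : ℝ) ^ 2 : ℝ) * (t : ℂ) ^ 2) =
          ((∫ t : ℝ, Real.exp (-(n : ℝ) ^ 2 * t ^ 2) : ℝ) : ℂ) := by
        rw [← integral_complex_ofReal]
        congr 1 with t
        push_cast
        rfl
      rw [h2, h1]
      have : (n : ℂ) ≠ 0 := by exact_mod_cast hn.ne'
      push_cast
      field_simp
    have hdiff : ∀ t : ℝ, ‖ω.1 (b * X s * α.at t c) - ω.1 (b * X s * c)‖ ≤ M * g t := fun t => by
      rw [← map_sub, ← mul_sub]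
      refine (norm_state_mul_le ω _ _).trans ?_
      gcongr
      exact hXb s
    have hint : Integrable fun t : ℝ => cexp (-((n : ℝ) ^ 2 : ℝ) * (t : ℂ) ^ 2) *
        ω.1 (b * X s * α.at t c) := by
      refine hG.mul_bdd (c := M * ‖c‖) (hDc s).aestronglyMeasurable (Eventually.of_forall fun t => ?_)
      refine (norm_state_le ω _).trans ((norm_mul_le _ _).trans ?_)
      rw [α.norm_at]
      gcongr
      exact hXb s
    have hsplit : (√Real.pi : ℝ) * ω.1 (b * X s * c) =
        n * (∫ t : ℝ, cexp (-((n : ℝ) ^ 2 : ℝ) * (t : ℂ) ^ 2) * ω.1 (b * X s * α.at t c)) -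
        n * ∫ t : ℝ, cexp (-((n : ℝ) ^ 2 : ℝ) * (t : ℂ) ^ 2) *
          (ω.1 (b * X s * α.at t c) - ω.1 (b * X s * c)) := by
      rw [← hGv, ← mul_sub, ← integral_sub hint, mul_assoc, ← integral_mul_const]
      · congr 2 with t
        ring
      · simp only [mul_sub]
        exact hint.sub (hG.mul_const _)
    have hbound : ‖∫ t : ℝ, cexp (-((n : ℝ) ^ 2 : ℝ) * (t : ℂ) ^ 2) *
        (ω.1 (b * X s * α.at t c) - ω.1 (b * X s * c))‖ ≤
        M * ∫ t : ℝ, Real.exp (-(n : ℝ) ^ 2 * t ^ 2) * g t := by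
      rw [← integral_const_mul]
      refine norm_integral_le_of_norm_le ((hgint _ hn').const_mul M)
        (Eventually.of_forall fun t => ?_)
      rw [norm_mul, hGn, mul_left_comm]
      gcongr
      exact hdiff t
    calc √Real.pi * ‖ω.1 (b * X s * c)‖ = ‖((√Real.pi : ℝ) : ℂ) * ω.1 (b * X s * c)‖ := by
          rw [norm_mul, norm_real, Real.norm_of_nonneg (Real.sqrt_nonneg _)]
      _ ≤ _ := by
          rw [hsplit]
          refine (norm_sub_le _ _).trans ?_
          rw [norm_mul, norm_mul, Complex.norm_natCast, add_comm, mul_left_comm]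
          gcongr
  have hD : Tendsto (fun s => ω.1 (b * X s * c)) atTop (𝓝 0) := by
    rw [Metric.tendsto_nhds]
    intro ε hε
    have hπ : 0 < √Real.pi := Real.sqrt_pos.2 Real.pi_pos
    have hn := (tendsto_gaussian_average hgc hg0 hgK).const_mul M
    rw [mul_zero] at hn
    -- The width is fixed first, uniformly in `s`; only afterwards does `s` tend to infinity.
    obtain ⟨n, hn1, hn2⟩ := ((hn.eventually_lt_const
      (show 0 < √Real.pi * ε / 2 by positivity)).and (eventually_gt_atTop 0)).exists
    have hs := (IsMixing.tendsto_integral_gaussian h hmix a b c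
      (show (0 : ℝ) < (n : ℝ) ^ 2 by positivity)).norm.const_mul (n : ℝ)
    rw [norm_zero, mul_zero] at hs
    filter_upwards [hs.eventually_lt_const (show 0 < √Real.pi * ε / 2 by positivity)] with s hs1
    rw [dist_zero_right]
    have := hsmear s n hn2
    exact lt_of_mul_lt_mul_left (by linarith) hπ.le
  have h3 := hD.add_const (ω.1 a * ω.1 (b * c))
  rw [zero_add] at h3
  refine h3.congr fun s => ?_
  rw [hX]
  simp only [mul_sub, sub_mul, map_sub, Algebra.algebraMap_eq_smul_one, mul_smul_comm, mul_one,
    smul_mul_assoc, map_smul, smul_eq_mul, sub_add_cancel]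

end Equilibrium
end AQFT

namespace AQFT

/-! ### Cyclicity of the trace -/

section TraceClass

open ContinuousLinearMap

variable {H : Type*} [NormedAddCommGroup H] [InnerProductSpace ℂ H] [CompleteSpace H]

lemma hasSum_norm_inner_sq {H : Type*} [NormedAddCommGroup H] [InnerProductSpace ℂ H]
    {ι : Type*} (b : HilbertBasis ι ℂ H) (x : H) :
    HasSum (fun i => ‖⟪x, b i⟫_ℂ‖ ^ 2) (‖x‖ ^ 2) := by
  have h := b.hasSum_inner_mul_inner x x
  rw [inner_self_eq_norm_sq_to_K] at h
  have h2 : ∀ i, ⟪x, b i⟫_ℂ * ⟪b i, x⟫_ℂ = ((‖⟪x, b i⟫_ℂ‖ ^ 2 : ℝ) : ℂ) := fun i => by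
    rw [← inner_conj_symm (b i) x, RCLike.mul_conj]
    norm_cast
  simp only [h2] at h
  exact Complex.hasSum_ofReal.1 (by simpa using h)

lemma summable_prod_of_hasSum {ι κ : Type*} {f : ι × κ → ℝ} {g : ι → ℝ} (hf : ∀ p, 0 ≤ f p)
    (h : ∀ i, HasSum (fun j => f (i, j)) (g i)) (hg : Summable g) : Summable f := by
  rw [summable_prod_of_nonneg hf]
  exact ⟨fun i => (h i).summable, by simpa only [(h _).tsum_eq] using hg⟩

/-- For self-adjoint `R` with `R²` of trace class, the trace of `R² T` equals that of `R T R`. -/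
lemma hasSum_inner_sqrt {ι : Type*} (b : HilbertBasis ι ℂ H) {R : H →L[ℂ] H}
    (hR : IsSelfAdjoint R) {c : ℂ} (hc : HasSum (fun i => ⟪b i, (R * R) (b i)⟫_ℂ) c)
    (T : H →L[ℂ] H) {d : ℂ} (hd : HasSum (fun i => ⟪b i, (R * R * T) (b i)⟫_ℂ) d) :
    HasSum (fun i => ⟪R (b i), T (R (b i))⟫_ℂ) d := by
  have hsymm : ∀ x y, ⟪R x, y⟫_ℂ = ⟪x, R y⟫_ℂ := hR.isSymmetric
  have hHS : Summable fun i => ‖R (b i)‖ ^ 2 := by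
    refine (Complex.hasSum_re hc).summable.congr fun i => ?_
    change (⟪b i, R (R (b i))⟫_ℂ).re = _
    rw [← hsymm]
    exact (norm_sq_eq_re_inner (𝕜 := ℂ) _).symm
  -- By Parseval, summing over the second index gives the diagonal of `R * R * T`, over the first
  -- that of `R * T * R`. Both factors are square summable because `R` is Hilbert–Schmidt, so the
  -- sums may be exchanged.
  set f : ι × ι → ℂ := fun p => ⟪R (b p.1), b p.2⟫_ℂ * ⟪adjoint T (R (b p.2)), b p.1⟫_ℂ with hf
  have hs1 : Summable fun p : ι × ι => ‖⟪R (b p.1), b p.2⟫_ℂ‖ ^ 2 :=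
    summable_prod_of_hasSum (fun _ => sq_nonneg _)
      (fun i => hasSum_norm_inner_sq b (R (b i))) hHS
  have hs2 : Summable fun p : ι × ι => ‖⟪adjoint T (R (b p.2)), b p.1⟫_ℂ‖ ^ 2 := by
    have hHS' : Summable fun j => ‖adjoint T (R (b j))‖ ^ 2 := by
      refine (hHS.mul_left (‖adjoint T‖ ^ 2)).of_nonneg_of_le (fun _ => sq_nonneg _) fun i => ?_
      rw [← mul_pow]
      gcongr
      exact le_opNorm _ _
    exact (Equiv.prodComm ι ι).summable_iff.1 (summable_prod_of_hasSum
      (f := fun q : ι × ι => ‖⟪adjoint T (R (b q.1)), b q.2⟫_ℂ‖ ^ 2) (fun _ => sq_nonneg _)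
      (fun j => hasSum_norm_inner_sq b (adjoint T (R (b j)))) hHS')
  have hfs : Summable f := by
    refine (hs1.add hs2).of_norm_bounded fun p => ?_
    rw [hf, norm_mul]
    nlinarith [sq_nonneg (‖⟪R (b p.1), b p.2⟫_ℂ‖ - ‖⟪adjoint T (R (b p.2)), b p.1⟫_ℂ‖),
      norm_nonneg ⟪R (b p.1), b p.2⟫_ℂ, norm_nonneg ⟪adjoint T (R (b p.2)), b p.1⟫_ℂ]
  have h1 : ∀ i, HasSum (fun j => f (i, j)) ⟪b i, (R * R * T) (b i)⟫_ℂ := fun i => by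
    have h := b.hasSum_inner_mul_inner (R (b i)) (R (T (b i)))
    rw [hsymm (b i)] at h
    refine h.congr_fun fun j => ?_
    simp only [hf, adjoint_inner_left, hsymm]
  have h2 : ∀ j, HasSum (fun i => f (i, j)) ⟪R (b j), T (R (b j))⟫_ℂ := fun j => by
    have h := b.hasSum_inner_mul_inner (adjoint T (R (b j))) (R (b j))
    rw [adjoint_inner_left] at h
    refine h.congr_fun fun i => ?_
    simp only [hf, hsymm]
    ring
  have hd' : HasSum f d := by
    have := (hfs.hasSum.prod_fiberwise h1).unique hd
    exact this ▸ hfs.hasSum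
  have hsw : HasSum (f ∘ (Equiv.prodComm ι ι)) d := (Equiv.prodComm ι ι).hasSum_iff.2 hd'
  exact hsw.prod_fiberwise h2

end TraceClass

/-! ### Folium states as vector sums, and intertwiners -/

section Folium

lemma inner_map_star_mul_self {H : Type*} [NormedAddCommGroup H] [InnerProductSpace ℂ H]
    [CompleteSpace H] {A : Type*} [CStarAlgebra A] (π : A →⋆ₐ[ℂ] (H →L[ℂ] H)) (a : A) (x : H) :
    ⟪x, π (star a * a) x⟫_ℂ = ((‖π a x‖ ^ 2 : ℝ) : ℂ) := by
  rw [map_mul, map_star, ContinuousLinearMap.star_eq_adjoint]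
  change ⟪x, ContinuousLinearMap.adjoint (π a) (π a x)⟫_ℂ = _
  rw [ContinuousLinearMap.adjoint_inner_right, inner_self_eq_norm_sq_to_K]
  simp

variable {A : Type*} [CStarAlgebra A] [PartialOrder A] [StarOrderedRing A]

/-- A state in the folium of `ω` is a convergent sum of vector functionals. -/
lemma exists_hasSum_of_mem_folium {ω φ : State A} (h : φ ∈ folium ω) :
    ∃ (s : Set ω.1.GNS) (ξ : s → ω.1.GNS),
      ∀ a, HasSum (fun i => ⟪ξ i, ω.1.gnsStarAlgHom a (ξ i)⟫_ℂ) (φ.1 a) := by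
  obtain ⟨ρ, ⟨hρ, htr⟩, hφ⟩ := h
  obtain ⟨s, b, -⟩ := exists_hilbertBasis ℂ ω.1.GNS
  have h0 : 0 ≤ ρ := (ContinuousLinearMap.nonneg_iff_isPositive ρ).2 hρ
  have hsq : CFC.sqrt ρ * CFC.sqrt ρ = ρ := CFC.sqrt_mul_sqrt_self ρ h0
  refine ⟨s, fun i => CFC.sqrt ρ (b i), fun a => ?_⟩
  refine hasSum_inner_sqrt b (IsSelfAdjoint.of_nonneg (CFC.sqrt_nonneg ρ)) (c := 1) ?_ _ ?_
  · rw [hsq]; exact htr s b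
  · rw [hsq]; exact hφ a s b

/-- Each summand of `φ` is dominated by `φ` on positive elements, so sending the GNS vector of `a`
to `π_ω(a) ξ i` is a contraction; it is nonzero when `ξ i` is. -/
lemma exists_intertwiner_of_mem_folium {ω φ : State A} (h : φ ∈ folium ω) :
    ∃ W : φ.1.GNS →L[ℂ] ω.1.GNS, W ≠ 0 ∧
      ∀ a x, W (φ.1.gnsStarAlgHom a x) = ω.1.gnsStarAlgHom a (W x) := by
  obtain ⟨s, ξ, hξ⟩ := exists_hasSum_of_mem_folium h
  obtain ⟨i, hi⟩ : ∃ i, ξ i ≠ 0 := by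
    by_contra! h0
    have h1 := hξ 1
    simp only [h0, inner_zero_left, φ.2] at h1
    exact one_ne_zero (h1.unique hasSum_zero)
  have hle : ∀ a, ‖ω.1.gnsStarAlgHom a (ξ i)‖ ≤ ‖φ.1.toPreGNS a‖ := fun a => by
    have hterm := fun j => inner_map_star_mul_self ω.1.gnsStarAlgHom a (ξ j)
    have h1 := hξ (star a * a)
    have h2 := φ.1.preGNS_norm_sq (φ.1.toPreGNS a)
    simp only [PositiveLinearMap.ofPreGNS_toPreGNS] at h2
    rw [← h2] at h1
    simp only [hterm] at h1
    have h3 : HasSum (fun j => ‖ω.1.gnsStarAlgHom a (ξ j)‖ ^ 2) (‖φ.1.toPreGNS a‖ ^ 2) :=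
      Complex.hasSum_ofReal.1 (by simpa using h1)
    have h4 := le_hasSum h3 i fun j _ => by positivity
    exact (sq_le_sq₀ (norm_nonneg _) (norm_nonneg _)).1 h4
  let W₀ : φ.1.PreGNS →ₗ[ℂ] ω.1.GNS :=
    { toFun := fun x => ω.1.gnsStarAlgHom (φ.1.ofPreGNS x) (ξ i)
      map_add' := fun x y => by simp
      map_smul' := fun c x => by simp }
  let W₁ : φ.1.PreGNS →L[ℂ] ω.1.GNS := W₀.mkContinuous 1 fun x => by
    simpa [W₀] using hle (φ.1.ofPreGNS x)
  have hW : ∀ a, W₁.fromCompletion (gnsVec φ a) = ω.1.gnsStarAlgHom a (ξ i) := fun a => by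
    rw [gnsVec_eq_coe, ContinuousLinearMap.fromCompletion_apply_coe]
    simp [W₁, W₀]
  refine ⟨W₁.fromCompletion, fun h0 => hi ?_, fun a x => ?_⟩
  · have h1 := hW 1
    rw [h0] at h1
    simpa using h1.symm
  · refine (denseRange_gnsVec φ).induction_on (p := fun x => W₁.fromCompletion
      (φ.1.gnsStarAlgHom a x) = ω.1.gnsStarAlgHom a (W₁.fromCompletion x)) x
      (isClosed_eq (by fun_prop) (by fun_prop)) fun b => ?_
    rw [gnsStarAlgHom_gnsVec, hW, hW, map_mul]
    rfl

end Folium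
end AQFT

namespace AQFT

/-! ### Weak convergence to scalars in a representation -/

section Equilibrium

variable {H : Type*} [NormedAddCommGroup H] [InnerProductSpace ℂ H]

/-- Uniformly bounded operators give equicontinuous functionals, so convergence needs checking only
on a dense set. -/
lemma isClosed_setOf_tendsto_inner_right {ι : Type*} {l : Filter ι} {T : ι → H →L[ℂ] H} {C : ℝ}
    (hT : ∀ i, ‖T i‖ ≤ C) (k : ℂ) (χ : H) :
    IsClosed {ζ | Tendsto (fun i => ⟪χ, T i ζ⟫_ℂ) l (𝓝 (k * ⟪χ, ζ⟫_ℂ))} := by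
  refine Equicontinuous.isClosed_setOfPred_tendsto (F := fun i ζ => ⟪χ, T i ζ⟫_ℂ)
    (Metric.equicontinuous_of_continuity_modulus (fun r => ‖χ‖ * (C * r)) ?_ _ fun x y i => ?_)
    (by fun_prop)
  · exact Continuous.tendsto' (by fun_prop) _ _ (by simp)
  · rw [dist_eq_norm, ← inner_sub_right, ← map_sub, dist_eq_norm]
    refine (norm_inner_le_norm _ _).trans ?_
    gcongr
    exact (T i).le_of_opNorm_le (hT i) _

lemma isClosed_setOf_tendsto_inner_left {ι : Type*} {l : Filter ι} {T : ι → H →L[ℂ] H} {C : ℝ}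
    (hT : ∀ i, ‖T i‖ ≤ C) (k : ℂ) (ζ : H) :
    IsClosed {χ | Tendsto (fun i => ⟪χ, T i ζ⟫_ℂ) l (𝓝 (k * ⟪χ, ζ⟫_ℂ))} := by
  refine Equicontinuous.isClosed_setOfPred_tendsto (F := fun i χ => ⟪χ, T i ζ⟫_ℂ)
    (Metric.equicontinuous_of_continuity_modulus (fun r => r * (C * ‖ζ‖)) ?_ _ fun x y i => ?_)
    (by fun_prop)
  · exact Continuous.tendsto' (by fun_prop) _ _ (by simp)
  · rw [dist_eq_norm, ← inner_sub_left, dist_eq_norm]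
    refine (norm_inner_le_norm _ _).trans ?_
    gcongr
    exact (T i).le_of_opNorm_le (hT i) _

variable [CompleteSpace H] {A : Type*} [CStarAlgebra A]

/-- The vectors on which the time-evolved observables converge weakly to the scalars `f a`. -/
def equilibriumSubspace (π : A →⋆ₐ[ℂ] (H →L[ℂ] H)) (α : Dynamics A) (f : A → ℂ) :
    Submodule ℂ H where
  carrier := {ζ | ∀ (a : A) (χ : H),
    Tendsto (fun t : ℝ => ⟪χ, π (α.at t a) ζ⟫_ℂ) atTop (𝓝 (f a * ⟪χ, ζ⟫_ℂ))}
  zero_mem' a χ := by simp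
  add_mem' {x y} hx hy a χ := by
    simpa only [map_add, inner_add_right, mul_add] using (hx a χ).add (hy a χ)
  smul_mem' c x hx a χ := by
    simpa only [map_smul, inner_smul_right, mul_left_comm] using (hx a χ).const_mul c

lemma mem_equilibriumSubspace {π : A →⋆ₐ[ℂ] (H →L[ℂ] H)} {α : Dynamics A} {f : A → ℂ} {ζ : H} :
    ζ ∈ equilibriumSubspace π α f ↔ ∀ (a : A) (χ : H),
      Tendsto (fun t : ℝ => ⟪χ, π (α.at t a) ζ⟫_ℂ) atTop (𝓝 (f a * ⟪χ, ζ⟫_ℂ)) := Iff.rfl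

lemma norm_map_at_le (π : A →⋆ₐ[ℂ] (H →L[ℂ] H)) (α : Dynamics A) (t : ℝ) (a : A) :
    ‖π (α.at t a)‖ ≤ ‖a‖ :=
  (NonUnitalStarAlgHom.norm_apply_le π _).trans (α.norm_at t a).le

lemma isClosed_equilibriumSubspace (π : A →⋆ₐ[ℂ] (H →L[ℂ] H)) (α : Dynamics A) (f : A → ℂ) :
    IsClosed (equilibriumSubspace π α f : Set H) := by
  have h : (equilibriumSubspace π α f : Set H) = ⋂ (a : A) (χ : H),
      {ζ | Tendsto (fun t : ℝ => ⟪χ, π (α.at t a) ζ⟫_ℂ) atTop (𝓝 (f a * ⟪χ, ζ⟫_ℂ))} := by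
    ext ζ
    simp [mem_equilibriumSubspace]
  rw [h]
  exact isClosed_iInter fun a => isClosed_iInter fun χ =>
    isClosed_setOf_tendsto_inner_right (fun t => norm_map_at_le π α t a) _ _

lemma map_mem_equilibriumSubspace {H' : Type*} [NormedAddCommGroup H']
    [InnerProductSpace ℂ H'] [CompleteSpace H'] {π : A →⋆ₐ[ℂ] (H →L[ℂ] H)}
    {π' : A →⋆ₐ[ℂ] (H' →L[ℂ] H')} {α : Dynamics A} {f : A → ℂ} {W : H →L[ℂ] H'}
    (hW : ∀ a x, W (π a x) = π' a (W x)) {x : H} (hx : x ∈ equilibriumSubspace π α f) :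
    W x ∈ equilibriumSubspace π' α f := fun a χ => by
  simpa only [ContinuousLinearMap.adjoint_inner_left, hW] using
    hx a (ContinuousLinearMap.adjoint W χ)

variable [PartialOrder A] [StarOrderedRing A]

lemma equilibriumSubspace_eq_top {ω : State A} {α : Dynamics A} {f : A → ℂ}
    (h : ∀ a b c, Tendsto (fun t : ℝ => ω.1 (b * α.at t a * c)) atTop (𝓝 (f a * ω.1 (b * c)))) :
    equilibriumSubspace ω.1.gnsStarAlgHom α f = ⊤ := by
  rw [eq_top_iff]
  rintro ζ -
  refine (denseRange_gnsVec ω).induction_on (p := fun ζ => ζ ∈ equilibriumSubspace _ α f) ζ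
    (isClosed_equilibriumSubspace _ α f) fun c a χ => ?_
  refine (denseRange_gnsVec ω).induction_on (p := fun χ => Tendsto (fun t : ℝ =>
    ⟪χ, ω.1.gnsStarAlgHom (α.at t a) (gnsVec ω c)⟫_ℂ) atTop (𝓝 (f a * ⟪χ, gnsVec ω c⟫_ℂ))) χ
    (isClosed_setOf_tendsto_inner_left (fun t => norm_map_at_le _ α t a) _ _) fun b => ?_
  simpa only [inner_gnsVec_gnsStarAlgHom, inner_gnsVec] using h a (star b) c

lemma tendsto_of_equilibriumSubspace_eq_top {ω : State A} {α : Dynamics A} {f : A → ℂ}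
    (h : equilibriumSubspace ω.1.gnsStarAlgHom α f = ⊤) (a b c : A) :
    Tendsto (fun t : ℝ => ω.1 (b * α.at t a * c)) atTop (𝓝 (f a * ω.1 (b * c))) := by
  have hc : gnsVec ω c ∈ equilibriumSubspace ω.1.gnsStarAlgHom α f := h ▸ Submodule.mem_top
  simpa only [inner_gnsVec_gnsStarAlgHom, inner_gnsVec, star_star] using
    hc a (gnsVec ω (star b))

/-- In a factor representation, a nonzero intertwiner from a representation in which the dynamics
tends to equilibrium spreads the convergence to the whole space. -/
lemma IsPrimary.equilibriumSubspace_eq_top {H' : Type*} [NormedAddCommGroup H']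
    [InnerProductSpace ℂ H'] [CompleteSpace H'] {ω : State A} (hω : IsPrimary ω)
    {π : A →⋆ₐ[ℂ] (H' →L[ℂ] H')} {α : Dynamics A} {f : A → ℂ}
    (hπ : equilibriumSubspace π α f = ⊤) {W : H' →L[ℂ] ω.1.GNS} (hW0 : W ≠ 0)
    (hW : ∀ a x, W (π a x) = ω.1.gnsStarAlgHom a (W x)) :
    equilibriumSubspace ω.1.gnsStarAlgHom α f = ⊤ := by
  set E := equilibriumSubspace ω.1.gnsStarAlgHom α f
  -- `E` is stable under the commutant but not visibly under the algebra; `K` is its largest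
  -- algebra-invariant subspace.
  let K : Submodule ℂ ω.1.GNS := ⨅ a : A, E.comap (ω.1.gnsStarAlgHom a).toLinearMap
  have memK : ∀ {ζ}, ζ ∈ K ↔ ∀ a, ω.1.gnsStarAlgHom a ζ ∈ E := by
    intro ζ; simp [K, Submodule.mem_iInf]
  have hKclosed : IsClosed (K : Set ω.1.GNS) := by
    have h : (K : Set ω.1.GNS) = ⋂ a, ω.1.gnsStarAlgHom a ⁻¹' (E : Set ω.1.GNS) := by
      ext ζ; simp [memK]
    rw [h]
    exact isClosed_iInter fun a =>
      (isClosed_equilibriumSubspace _ α f).preimage (ω.1.gnsStarAlgHom a).continuous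
  have : CompleteSpace K := hKclosed.completeSpace_coe
  have hWK : ∀ x, W x ∈ K := fun x => memK.2 fun a => by
    rw [← hW]
    exact map_mem_equilibriumSubspace hW (hπ ▸ Submodule.mem_top)
  have hP : IsStarProjection K.starProjection := isStarProjection_starProjection
  have hcomm : ∀ a, ω.1.gnsStarAlgHom a * K.starProjection =
      K.starProjection * ω.1.gnsStarAlgHom a := by
    have h1 : ∀ a, K.starProjection * ω.1.gnsStarAlgHom a * K.starProjection =
        ω.1.gnsStarAlgHom a * K.starProjection := fun a => by
      ext x
      refine Submodule.starProjection_eq_self_iff.2 (memK.2 fun b => ?_)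
      have := memK.1 (K.starProjection_apply_mem x) (b * a)
      rwa [map_mul] at this
    intro a
    -- Since `K` is invariant under `a` and `star a`, its projection commutes with the
    -- representation.
    have h2 := congrArg star (h1 (star a))
    simp only [star_mul, map_star, star_star, hP.isSelfAdjoint.star_eq] at h2
    rw [← h2, ← mul_assoc, h1]
  have hmem : K.starProjection ∈ inducedVNA ω := by
    -- A projection lies in the algebra once its range is invariant under the commutant, whose
    -- elements are self-intertwiners.
    rw [VonNeumannAlgebra.IsStarProjection.mem_iff hP]
    intro y hy
    rw [VonNeumannAlgebra.mem_commutant_iff] at hy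
    have hya : ∀ a, ω.1.gnsStarAlgHom a * y = y * ω.1.gnsStarAlgHom a := fun a => by
      refine hy _ ?_
      rw [← SetLike.mem_coe, coe_inducedVNA]
      exact Set.subset_centralizer_centralizer ⟨a, rfl⟩
    rw [Submodule.range_starProjection]
    intro ζ hζ
    refine memK.2 fun a => ?_
    have h1 := map_mem_equilibriumSubspace (W := y)
      (π' := ω.1.gnsStarAlgHom)
      (fun a x => (congrArg (fun T : ω.1.GNS →L[ℂ] ω.1.GNS => T x) (hya a)).symm) (memK.1 hζ a)
    have h2 := congrArg (fun T : ω.1.GNS →L[ℂ] ω.1.GNS => T ζ) (hya a)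
    exact (show ω.1.gnsStarAlgHom a (y ζ) = y (ω.1.gnsStarAlgHom a ζ) from h2) ▸ h1
  have hmem' : K.starProjection ∈ (inducedVNA ω).commutant := by
    rw [VonNeumannAlgebra.mem_commutant_iff]
    intro g hg
    rw [← SetLike.mem_coe, coe_inducedVNA] at hg
    refine (hg _ ?_).symm
    rintro _ ⟨a, rfl⟩
    exact hcomm a
  obtain ⟨c, hc⟩ := hω _ hmem hmem'
  obtain ⟨x, hx⟩ : ∃ x, W x ≠ 0 := by
    by_contra! h0
    exact hW0 (ContinuousLinearMap.ext h0)
  have hc1 : c = 1 := by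
    have h1 : K.starProjection (W x) = W x := Submodule.starProjection_eq_self_iff.2 (hWK x)
    rw [hc] at h1
    have h2 : (c - 1) • W x = 0 := by
      rw [sub_smul, one_smul, sub_eq_zero]
      simpa using h1
    exact sub_eq_zero.1 ((smul_eq_zero.1 h2).resolve_right hx)
  rw [eq_top_iff]
  rintro ζ -
  have h1 : ζ ∈ K := by
    rw [← Submodule.starProjection_eq_self_iff, hc, hc1]
    simp
  simpa using memK.1 h1 1

end Equilibrium
end AQFT

namespace AQFT

/-! ### Equality or disjointness for commuting dynamics -/

section Disjointness

variable {A : Type*} [CStarAlgebra A] [PartialOrder A] [StarOrderedRing A]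

/-- The weak convergence of the dynamics to a mixing KMS state is inherited by the states in its
folium. -/
lemma IsMixing.equilibriumSubspace_eq_top_of_mem_folium {α : Dynamics A} {β : ℝ} {σ φ : State A}
    (h : IsKMS α β σ) (hmix : IsMixing α σ) (hφ : φ ∈ folium σ) :
    equilibriumSubspace φ.1.gnsStarAlgHom α σ.1 = ⊤ := by
  have hσ : equilibriumSubspace σ.1.gnsStarAlgHom α σ.1 = ⊤ :=
    equilibriumSubspace_eq_top (hmix.tendsto_apply_mul_mul h)
  obtain ⟨s, ξ, hξ⟩ := exists_hasSum_of_mem_folium hφ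
  refine equilibriumSubspace_eq_top fun a b c => ?_
  have hsum : Summable fun i => ‖ξ i‖ ^ 2 := by
    refine (Complex.hasSum_re (hξ 1)).summable.congr fun i => ?_
    rw [map_one]
    exact (norm_sq_eq_re_inner (𝕜 := ℂ) _).symm
  simp only [← (hξ _).tsum_eq, ← tsum_mul_left]
  refine tendsto_tsum_of_dominated_convergence (hsum.mul_left (‖b‖ * ‖a‖ * ‖c‖)) (fun i => ?_)
    (Eventually.of_forall fun t i => ?_)
  · have hc : σ.1.gnsStarAlgHom c (ξ i) ∈ equilibriumSubspace σ.1.gnsStarAlgHom α σ.1 :=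
      hσ ▸ Submodule.mem_top
    have h1 := hc a (ContinuousLinearMap.adjoint (σ.1.gnsStarAlgHom b) (ξ i))
    simp only [ContinuousLinearMap.adjoint_inner_left] at h1
    simp only [map_mul]
    exact h1
  · refine (norm_inner_le_norm _ _).trans ?_
    have h1 : ‖σ.1.gnsStarAlgHom (b * α.at t a * c)‖ ≤ ‖b‖ * ‖a‖ * ‖c‖ := by
      refine (norm_gnsStarAlgHom_le σ _).trans ((norm_mul_le _ _).trans ?_)
      gcongr
      refine (norm_mul_le _ _).trans ?_
      rw [α.norm_at]
    calc ‖ξ i‖ * ‖σ.1.gnsStarAlgHom (b * α.at t a * c) (ξ i)‖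
        ≤ ‖ξ i‖ * (‖b‖ * ‖a‖ * ‖c‖ * ‖ξ i‖) := by
          gcongr
          exact ContinuousLinearMap.le_of_opNorm_le _ h1 _
      _ = _ := by ring

/-- A primary state that is not disjoint from a mixing KMS state returns to equilibrium. -/
lemma IsMixing.tendsto_of_not_areDisjoint {α : Dynamics A} {β : ℝ} {σ ω φ : State A}
    (h : IsKMS α β σ) (hmix : IsMixing α σ) (hω : IsPrimary ω) (hφσ : φ ∈ folium σ)
    (hφω : φ ∈ folium ω) (a : A) :
    Tendsto (fun t : ℝ => ω.1 (α.at t a)) atTop (𝓝 (σ.1 a)) := by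
  obtain ⟨W, hW0, hW⟩ := exists_intertwiner_of_mem_folium hφω
  simpa [ω.2] using tendsto_of_equilibriumSubspace_eq_top (hω.equilibriumSubspace_eq_top
    (hmix.equilibriumSubspace_eq_top_of_mem_folium h hφσ) hW0 hW) a 1 1

/-- Primary mixing KMS states of commuting dynamics are equal or disjoint. -/
theorem areDisjoint_of_commute {α α' : Dynamics A}
    (hcomm : ∀ s t a, α.at s (α'.at t a) = α'.at t (α.at s a)) {β β' : ℝ} {σ ω : State A}
    (hσ : IsKMS α β σ) (hω : IsKMS α' β' ω) (hσp : IsPrimary σ) (hωp : IsPrimary ω)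
    (hσm : IsMixing α σ) (hωm : IsMixing α' ω) (hne : σ ≠ ω) : AreDisjoint σ ω := by
  rw [AreDisjoint, Set.eq_empty_iff_forall_notMem]
  rintro φ ⟨hφσ, hφω⟩
  -- `ω (α_s (α'_t a)) = ω (α_s a)` by commutation and invariance; its limits in `s` are `σ (α'_t
  -- a)` and `σ a`.
  have hinv : ∀ t a, σ.1 (α'.at t a) = σ.1 a := fun t a => by
    refine tendsto_nhds_unique
      (hσm.tendsto_of_not_areDisjoint hσ hωp hφσ hφω (α'.at t a)) ?_
    simpa only [hcomm, hωm.1 t] using hσm.tendsto_of_not_areDisjoint hσ hωp hφσ hφω a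
  refine hne (Subtype.ext (DFunLike.ext _ _ fun a => ?_))
  -- With the roles exchanged, `σ (α'_t a) → ω a`, although the left side is constantly `σ a`.
  have h := hωm.tendsto_of_not_areDisjoint hω hσp hφω hφσ a
  simp only [hinv] at h
  exact tendsto_nhds_unique tendsto_const_nhds h

end Disjointness

lemma LocalNet.timeTranslation_at_comm {d : ℕ} {A : Type*} [CStarAlgebra A] (N : LocalNet d A)
    (u w : Spacetime d) (s t : ℝ) (a : A) :
    (N.timeTranslation u).at s ((N.timeTranslation w).at t a) =
      (N.timeTranslation w).at t ((N.timeTranslation u).at s a) := by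
  have h : ∀ x y : Multiplicative (Spacetime d),
      N.translation x (N.translation y a) = N.translation (x * y) a := fun x y => by
    rw [map_mul]; rfl
  rw [N.timeTranslation_at, N.timeTranslation_at, h, h, mul_comm]

end AQFT

theorem corollary3p5 {d : ℕ} (hd : 1 ≤ d)
    {A : Type*} [CStarAlgebra A] [PartialOrder A] [StarOrderedRing A]
    (N : LocalNet d A)
    (u w : Spacetime d) (hu : IsFrame u) (hw : IsFrame w) (huw : LinearIndependent ℝ ![u, w])
    (σ ω : State A) (β₁ β₂ : ℝ)
    (hσKMS : IsKMS (N.timeTranslation u) β₁ σ) (hωKMS : IsKMS (N.timeTranslation w) β₂ ω)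
    (hσ : IsPrimary σ) (hω : IsPrimary ω)
    (hσmix : IsMixing (N.timeTranslation u) σ) (hωmix : IsMixing (N.timeTranslation w) ω)
    (hne : σ ≠ ω) :
    AreDisjoint σ ω := by
  exact areDisjoint_of_commute (N.timeTranslation_at_comm u w) hσKMS hωKMS hσ hω hσmix hωmix hne
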